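/- Let $G=(V,E)$ be a finite tree with edge weights $w:E\to\mathbb{R}_+$, let $q\ge 1$, and let $T_1,\dots,T_q\subseteq V$ be candidate sets. For $C\subseteq E$ let $w(C)=\sum_{e\in C}w(e)$. The Single-to-Single problem asks for a set $C\subseteq E$ of minimum weight for which there are representatives $t_i\in T_i$ ($i=1,\dots,q$) such that $t_i$ and $t_j$ lie in different components of $G-C$ for all $i\ne j$; the instance is feasible if at least one such $C$ exists. Call $C\subseteq E$ good if there are $I\subseteq\{1,\dots,q\}$ with $|I|=|C|+1$ and $t_i\in T_i$ for $i\in I$ such that each component of $G-C$ contains exactly one of the representatives $t_i$, $i\in I$. (1) Let $r\in V$ be arbitrary and orient the edges of $G$ towards $r$. Then each node $v\ne r$ is left by exactly one arc; let $e(v)$ be the corresponding edge. The map $Z\mapsto\{e(v):v\in Z\}$ is a bijection from the subsets of $V\setminus\{r\}$ to the subsets of $E$. Let $D$ be the digraph obtained from the oriented tree by adding new nodes $s_1,\dots,s_q$ and an arc from $s_i$ to each element of $T_i$, for every $i$. The sets $X\subseteq V$ for which there are $|X|$ pairwise node-disjoint directed paths in $D$ from elements of $\{s_1,\dots,s_q\}$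 into $X$ are the independent sets of a matroid $M$ on $V$ (the gammoid $(D,\{s_1,\dots,s_q\},V)$), and for every $Z\subseteq V\setminus\{r\}$ the set $\{e(v):v\in Z\}$ is a good cut if and only if $Z\cup\{r\}$ is independent in $M$. (2) Consider the greedy algorithm that starts with $C=\emptyset$ and, while $|C|<q-1$, adds to $C$ an edge $e$ of minimum weight $w(e)$ among all edges $e\in E\setminus C$ for which $C\cup\{e\}$ is good, ties being broken arbitrarily. If the instance is feasible, then in each iteration such an edge exists, so the algorithm terminates with an output, and every possible output $C$ is a good cut with $q-1$ edges, has minimum weight among all good cuts with $q-1$ edges, and is an optimal solution of Single-to-Single. -/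

import Mathlib

/-- A path from `a` to `b` in a digraph, given by the list of its nodes: the nodes are distinct,
consecutive nodes are joined by arcs, the first node is `a` and the last one is `b`. -/
def IsDipath {N : Type*} (D : Digraph N) (a b : N) (p : List N) : Prop :=
  p.Nodup ∧ p.IsChain D.Adj ∧ p.head? = some a ∧ p.getLast? = some b

/-- There are `|X|` pairwise node-disjoint paths from elements of `S` into `X`. Disjoint paths
have different end nodes, so exactly one of them, here `P x`, ends in each `x ∈ X`. -/
def IsLinkedInto {N : Type*} (D : Digraph N) (S X : Set N) : Prop :=
  ∃ P : N → List N,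
    (∀ x ∈ X, ∃ s ∈ S, IsDipath D s x (P x)) ∧
    ∀ x ∈ X, ∀ y ∈ X, x ≠ y → (P x).Disjoint (P y)

/-- `M` is the gammoid `(D, S, T)`: the matroid with ground set `T`, where `T` is disjoint from
the set `S` of sources, in which `X ⊆ T` is independent iff there are `|X|` node-disjoint paths
from elements of `S` into `X`. -/
def IsGammoid {N : Type*} (M : Matroid N) (D : Digraph N) (S T : Set N) : Prop :=
  Disjoint S T ∧ M.E = T ∧ ∀ X : Set N, X ⊆ T → (M.Indep X ↔ IsLinkedInto D S X)

/-- The digraph on the nodes of `G` and one additional node `s i` for each candidate set `T i`: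
the edges of `G` are oriented towards `r` (from the end farther from `r` to the closer one), and
there is an arc from `s i` to each element of `T i`. -/
def candidateDigraph {V : Type*} {q : ℕ} (G : SimpleGraph V) (T : Fin q → Set V) (r : V) :
    Digraph (V ⊕ Fin q) where
  Adj
    | Sum.inl u, Sum.inl v => G.Adj u v ∧ G.dist v r < G.dist u r
    | Sum.inr i, Sum.inl v => v ∈ T i
    | _, Sum.inr _ => False

/-- The set `{e(v) : v ∈ Z}`, where `e(v)` is the edge of `G` which, oriented towards `r`,
leaves the node `v`. -/
noncomputable def outCut {V : Type*} [Finite V] (G : SimpleGraph V) (r : V) (Z : Finset V) :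
    Finset (Sym2 V) :=
  (Set.toFinite {e : Sym2 V |
    ∃ v ∈ Z, ∃ u, G.Adj v u ∧ G.dist u r < G.dist v r ∧ e = s(v, u)}).toFinset

/-- A cut `C` is good if one can choose `|C| + 1` representatives `t i ∈ T i`, `i ∈ I`, such that
each component of `G - C` contains exactly one of them. (In particular, `t` is then injective on
`I`, so the representatives form a partial transversal.) -/
def IsGoodCut {V : Type*} {q : ℕ} (G : SimpleGraph V) (T : Fin q → Set V)
    (C : Finset (Sym2 V)) : Prop :=
  (C : Set (Sym2 V)) ⊆ G.edgeSet ∧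
  ∃ (I : Finset (Fin q)) (t : Fin q → V),
    I.card = C.card + 1 ∧ (∀ i ∈ I, t i ∈ T i) ∧
    ∀ K : (G.deleteEdges (C : Set (Sym2 V))).ConnectedComponent,
      ∃! i, i ∈ I ∧ (G.deleteEdges (C : Set (Sym2 V))).connectedComponentMk (t i) = K

/-- `C` is a feasible solution of Single-to-Single: there are representatives `t i ∈ T i`, one for
every `i`, that are pairwise separated by `C`. -/
def IsSingleToSingle {V : Type*} {q : ℕ} (G : SimpleGraph V) (T : Fin q → Set V)
    (C : Finset (Sym2 V)) : Prop :=
  (C : Set (Sym2 V)) ⊆ G.edgeSet ∧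
  ∃ t : Fin q → V, (∀ i, t i ∈ T i) ∧
    ∀ i j, i ≠ j → ¬ (G.deleteEdges (C : Set (Sym2 V))).Reachable (t i) (t j)

/-- `C` is an optimal solution of Single-to-Single: feasible, and of minimum weight. -/
def IsOptimalSingleToSingle {V : Type*} {q : ℕ} (G : SimpleGraph V) (w : Sym2 V → ℝ)
    (T : Fin q → Set V) (C : Finset (Sym2 V)) : Prop :=
  IsSingleToSingle G T C ∧
  ∀ C' : Finset (Sym2 V), IsSingleToSingle G T C' → ∑ e ∈ C, w e ≤ ∑ e ∈ C', w e

/-- One iteration of the loop of the greedy algorithm, for an arbitrary way to break ties: while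
`|C| < q - 1`, an edge `e ∉ C` such that `C + e` is good is chosen with `w e` minimum, and `C` is
replaced by `C + e`. -/
def GreedyStep {V : Type*} [DecidableEq V] {q : ℕ} (G : SimpleGraph V) (w : Sym2 V → ℝ)
    (T : Fin q → Set V) (C C' : Finset (Sym2 V)) : Prop :=
  C.card + 1 < q ∧
  ∃ e : Sym2 V, e ∉ C ∧ IsGoodCut G T (insert e C) ∧
    (∀ f : Sym2 V, f ∉ C → IsGoodCut G T (insert f C) → w e ≤ w f) ∧
    C' = insert e C

/-- `C` is a possible value of the variable `C` during the greedy algorithm, which starts with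
the empty set. -/
def GreedyReaches {V : Type*} [DecidableEq V] {q : ℕ} (G : SimpleGraph V) (w : Sym2 V → ℝ)
    (T : Fin q → Set V) (C : Finset (Sym2 V)) : Prop :=
  Relation.ReflTransGen (GreedyStep G w T) ∅ C

/-- `C` is a possible output of the greedy algorithm: it is reached and the loop condition
`|C| < q - 1` fails. -/
def IsGreedyOutput {V : Type*} [DecidableEq V] {q : ℕ} (G : SimpleGraph V) (w : Sym2 V → ℝ)
    (T : Fin q → Set V) (C : Finset (Sym2 V)) : Prop :=
  GreedyReaches G w T C ∧ ¬ C.card + 1 < q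

/-! Let X = Z ∪ {r}. Deleting the edges that leave Z splits the tree into components, each
containing exactly one element of X, its node nearest to `r`; a node lies in the component of the
first element of X on its way to `r`. Hence a cut is good iff X is matchable (`IsMatchable`,
`isGoodCut_outCut_iff`). In the digraph a path from s_i must follow the tree towards `r` after its
first arc, so disjoint paths into X amount to the same matching (`isLinkedInto_iff_isMatchable`).

Matchable sets form a matroid because they are linearly represented. Give each pair (i, t) with t ∈
T_i an indeterminate, and let the vector of x be the sum of the generic columns of all descendants
of x. On X these vectors arise by a triangular change of basis from the sums over the components,
whose supports are disjoint. The latter are independent iff the components have distinct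
representatives, by Hall's theorem in one direction and a 0-1 specialisation in the other
(`isMatchable_iff_linearIndepOn`). Exchange is then a dimension count.

Since `r` belongs to every X considered, good cuts inherit heredity and exchange, so greedy yields a
lightest good cut with q - 1 edges. Every feasible cut contains such a good cut
(`IsSingleToSingle.exists_isGoodCut`), so nonnegative weights make the greedy output optimal. -/

/-- `v` is the node following `u` when the edges of `G` are oriented towards `r`. -/
def IsParent {V : Type*} (G : SimpleGraph V) (r u v : V) : Prop :=
  G.Adj u v ∧ G.dist v r < G.dist u r

/-- `v` lies on the path from `u` to `r`. -/
def IsAncestor {V : Type*} (G : SimpleGraph V) (r : V) : V → V → Prop :=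
  Relation.ReflTransGen (IsParent G r)

/-- `x` is the first node of `X` on the path from `u` to `r`. -/
def IsFirstAncestor {V : Type*} (G : SimpleGraph V) (r : V) (X : Set V) (u x : V) : Prop :=
  x ∈ X ∧ IsAncestor G r u x ∧ ∀ y ∈ X, IsAncestor G r u y → IsAncestor G r x y

/-! ### The tree order towards the root. -/

section Ancestor

variable {V : Type*} {G : SimpleGraph V} {r : V}

/-- A shortest path from a parent of `v` to `r` avoids `v`, which is farther away. Prepending `v`
gives the unique path from `v` to `r`, so the parent is its second node. -/
theorem SimpleGraph.IsTree.existsUnique_isParent (hG : G.IsTree) {v : V} (hv : v ≠ r) :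
    ∃! u, IsParent G r v u := by
  classical
  have key : ∀ u, IsParent G r v u → ∃ p : G.Walk v r, p.IsPath ∧ p.snd = u := by
    rintro u ⟨hadj, hlt⟩
    obtain ⟨p, hp, hlen⟩ := (hG.connected u r).exists_path_of_dist
    refine ⟨SimpleGraph.Walk.cons hadj p, ?_, by simp⟩
    rw [SimpleGraph.Walk.cons_isPath_iff]
    refine ⟨hp, fun hmem => ?_⟩
    have h1 := SimpleGraph.dist_le (p.dropUntil v hmem)
    have h2 := p.length_dropUntil_le_length hmem
    omega
  obtain ⟨p, hp, hlen⟩ := (hG.connected v r).exists_path_of_dist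
  cases p with
  | nil => exact absurd rfl hv
  | @cons _ u _ hadj p' =>
    refine ⟨u, ⟨hadj, ?_⟩, fun u' hu' => ?_⟩
    · have := SimpleGraph.dist_le p'
      simp only [SimpleGraph.Walk.length_cons] at hlen
      omega
    · obtain ⟨p1, hp1, h1⟩ := key u' hu'
      have := (hG.existsUnique_path v r).unique hp hp1
      rw [← h1, ← this]
      simp

theorem IsParent.ne_root {u v : V} (h : IsParent G r u v) : u ≠ r := by
  rintro rfl
  simpa using h.2

theorem IsParent.unique (hG : G.IsTree) {u v w : V} (h : IsParent G r u v)
    (h' : IsParent G r u w) : v = w :=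
  (hG.existsUnique_isParent h.ne_root).unique h h'

theorem SimpleGraph.IsTree.isParent_or_isParent (hG : G.IsTree) (r : V) {u v : V}
    (h : G.Adj u v) : IsParent G r u v ∨ IsParent G r v u := by
  have h1 := hG.dist_ne_of_adj r h
  rw [G.dist_comm, G.dist_comm (u := r)] at h1
  rcases lt_or_gt_of_ne h1 with h1 | h1
  · exact Or.inr ⟨h.symm, h1⟩
  · exact Or.inl ⟨h, h1⟩

theorem IsAncestor.dist_le {u v : V} (h : IsAncestor G r u v) : G.dist v r ≤ G.dist u r := by
  induction h with
  | refl => exact le_rfl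
  | tail _ h ih => exact h.2.le.trans ih

theorem IsAncestor.antisymm {u v : V} (h : IsAncestor G r u v) (h' : IsAncestor G r v u) :
    u = v := by
  rcases Relation.ReflTransGen.cases_head h with h1 | ⟨w, h1, h2⟩
  · exact h1
  · have h3 := IsAncestor.dist_le h2
    have h4 := IsAncestor.dist_le h'
    have h5 := h1.2
    omega

theorem IsAncestor.total (hG : G.IsTree) {u v w : V} (h : IsAncestor G r u v)
    (h' : IsAncestor G r u w) : IsAncestor G r v w ∨ IsAncestor G r w v :=
  Relation.ReflTransGen.total_of_right_unique (fun _ _ _ h1 h2 => IsParent.unique hG h1 h2) h h'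

theorem SimpleGraph.IsTree.isAncestor_root (hG : G.IsTree) (u : V) : IsAncestor G r u r := by
  induction h : G.dist u r using Nat.strong_induction_on generalizing u with
  | _ n ih =>
    by_cases hu : u = r
    · rw [hu]; exact Relation.ReflTransGen.refl
    · obtain ⟨v, hv, -⟩ := hG.existsUnique_isParent hu
      exact Relation.ReflTransGen.head hv (ih _ (h ▸ hv.2) v rfl)

theorem IsFirstAncestor.unique {X : Set V} {u x y : V} (hx : IsFirstAncestor G r X u x)
    (hy : IsFirstAncestor G r X u y) : x = y :=
  IsAncestor.antisymm (hx.2.2 y hy.1 hy.2.1) (hy.2.2 x hx.1 hx.2.1)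

theorem IsFirstAncestor.self {X : Set V} {x : V} (hx : x ∈ X) : IsFirstAncestor G r X x x :=
  ⟨hx, Relation.ReflTransGen.refl, fun _ _ h => h⟩

theorem exists_isFirstAncestor (hG : G.IsTree) {X : Set V} {u x : V} (hx : x ∈ X)
    (hux : IsAncestor G r u x) : ∃ y, IsFirstAncestor G r X u y := by
  induction hux using Relation.ReflTransGen.head_induction_on with
  | refl => exact ⟨_, IsFirstAncestor.self hx⟩
  | @head a c h _ ih =>
    by_cases ha : a ∈ X
    · exact ⟨a, IsFirstAncestor.self ha⟩
    · obtain ⟨y, hy⟩ := ih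
      refine ⟨y, hy.1, Relation.ReflTransGen.head h hy.2.1, fun z hz haz => hy.2.2 z hz ?_⟩
      rcases Relation.ReflTransGen.cases_head haz with h1 | ⟨w, h1, h2⟩
      · exact absurd (h1 ▸ hz) ha
      · rwa [← IsParent.unique hG h1 h]

theorem IsFirstAncestor.mono {X Y : Set V} {u x : V} (h : IsFirstAncestor G r X u x)
    (hYX : Y ⊆ X) (hx : x ∈ Y) : IsFirstAncestor G r Y u x :=
  ⟨hx, h.2.1, fun y hy => h.2.2 y (hYX hy)⟩

/-- This makes first ancestors constant along uncut edges, hence on components. -/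
theorem IsParent.isFirstAncestor_iff (hG : G.IsTree) {X : Set V} {u v x : V}
    (h : IsParent G r u v) (hu : u ∉ X) :
    IsFirstAncestor G r X u x ↔ IsFirstAncestor G r X v x := by
  have key : ∀ z ∈ X, IsAncestor G r u z ↔ IsAncestor G r v z := by
    refine fun z hz => ⟨fun huz => ?_, fun hvz => Relation.ReflTransGen.head h hvz⟩
    rcases Relation.ReflTransGen.cases_head huz with h1 | ⟨w, h1, h2⟩
    · exact absurd (h1 ▸ hz) hu
    · rwa [← IsParent.unique hG h1 h]
  constructor
  · exact fun hx => ⟨hx.1, (key x hx.1).1 hx.2.1, fun y hy hvy => hx.2.2 y hy ((key y hy).2 hvy)⟩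
  · exact fun hx => ⟨hx.1, (key x hx.1).2 hx.2.1, fun y hy hvy => hx.2.2 y hy ((key y hy).1 hvy)⟩

theorem IsParent.eq_of_edge_eq {u v u' v' : V} (h : IsParent G r v u) (h' : IsParent G r v' u')
    (he : s(v, u) = s(v', u')) : v = v' := by
  rcases Sym2.eq_iff.1 he with ⟨h1, -⟩ | ⟨rfl, rfl⟩
  · exact h1
  · exact absurd h.2 (not_lt_of_gt h'.2)

end Ancestor

/-- There are representatives `t x ∈ T (i x)`, `x ∈ X`, of different candidate sets such that `x`
is the first node of `X` on the path from `t x` to `r`. -/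
def IsMatchable {V : Type*} {q : ℕ} (G : SimpleGraph V) (T : Fin q → Set V) (r : V)
    (X : Set V) : Prop :=
  ∃ (i : V → Fin q) (t : V → V), Set.InjOn i X ∧
    ∀ x ∈ X, t x ∈ T (i x) ∧ IsFirstAncestor G r X (t x) x

/-! ### Disjoint directed paths as matchings. -/

section Linking

variable {V : Type*} {G : SimpleGraph V} {r : V} {q : ℕ} {T : Fin q → Set V}

theorem candidateDigraph_adj_inr {i : Fin q} {v : V} :
    (candidateDigraph G T r).Adj (Sum.inr i) (Sum.inl v) ↔ v ∈ T i := Iff.rfl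

theorem exists_isChain_of_isAncestor {u v : V} (h : IsAncestor G r u v) :
    ∃ l : List V, l.IsChain (IsParent G r) ∧ l.head? = some u ∧ l.getLast? = some v ∧ l.Nodup ∧
      ∀ z ∈ l, IsAncestor G r u z ∧ IsAncestor G r z v := by
  induction h using Relation.ReflTransGen.head_induction_on with
  | refl => exact ⟨[v], by simp, by simp, by simp, by simp, by
      simp only [List.mem_singleton, forall_eq]
      exact ⟨Relation.ReflTransGen.refl, Relation.ReflTransGen.refl⟩⟩
  | @head a c hac hcv ih =>
    obtain ⟨l, h1, h2, h3, h4, h5⟩ := ih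
    refine ⟨a :: l, ?_, by simp, ?_, ?_, ?_⟩
    · rw [List.isChain_cons]
      refine ⟨fun y hy => ?_, h1⟩
      rw [h2] at hy
      simp only [Option.mem_def, Option.some.injEq] at hy
      exact hy ▸ hac
    · rw [List.getLast?_cons, h3]; rfl
    · refine List.nodup_cons.2 ⟨fun ha => ?_, h4⟩
      have := IsAncestor.dist_le (h5 a ha).1
      have := hac.2
      omega
    · intro z hz
      rcases List.mem_cons.1 hz with rfl | hz
      · exact ⟨Relation.ReflTransGen.refl, Relation.ReflTransGen.head hac hcv⟩
      · exact ⟨Relation.ReflTransGen.head hac (h5 z hz).1, (h5 z hz).2⟩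

/-- A tree node has an arc only to its parent, so the path is forced. Its containing every
intermediate node is what lets disjointness exclude other elements of X. -/
theorem isAncestor_of_isChain (hG : G.IsTree) {t x : V} {l : List (V ⊕ Fin q)}
    (hl : l.IsChain (candidateDigraph G T r).Adj) (hhead : l.head? = some (Sum.inl t))
    (hlast : l.getLast? = some (Sum.inl x)) :
    IsAncestor G r t x ∧
      ∀ z, IsAncestor G r t z → IsAncestor G r z x → Sum.inl z ∈ l := by
  induction l generalizing t with
  | nil => simp at hhead
  | cons a l ih =>
    simp only [List.head?_cons, Option.some.injEq] at hhead
    subst hhead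
    cases l with
    | nil =>
      simp only [List.getLast?_singleton, Option.some.injEq, Sum.inl.injEq] at hlast
      subst hlast
      exact ⟨Relation.ReflTransGen.refl, fun z h1 h2 => by simp [IsAncestor.antisymm h1 h2]⟩
    | cons b l =>
      rw [List.isChain_cons_cons] at hl
      cases b with
      | inr i => exact absurd hl.1 (by simp [candidateDigraph])
      | inl c =>
        have hp : IsParent G r t c := hl.1
        rw [List.getLast?_cons_cons] at hlast
        obtain ⟨h1, h2⟩ := ih (t := c) hl.2 rfl hlast
        refine ⟨Relation.ReflTransGen.head hp h1, fun z hz hzx => ?_⟩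
        rcases Relation.ReflTransGen.cases_head hz with h | ⟨w, h, h'⟩
        · simp [h]
        · rw [IsParent.unique hG h hp] at h'
          exact List.mem_cons_of_mem _ (h2 z h' hzx)

theorem isLinkedInto_iff_isMatchable [Nonempty (Fin q)] (hG : G.IsTree) (X : Set V) :
    IsLinkedInto (candidateDigraph G T r) (Set.range Sum.inr) (Sum.inl '' X) ↔
      IsMatchable G T r X := by
  constructor
  · rintro ⟨P, hP, hdisj⟩
    have key : ∀ x : V, ∃ (i : Fin q) (t : V), x ∈ X → t ∈ T i ∧ Sum.inr i ∈ P (Sum.inl x) ∧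
        Sum.inl x ∈ P (Sum.inl x) ∧ IsAncestor G r t x ∧
        ∀ z, IsAncestor G r t z → IsAncestor G r z x → Sum.inl z ∈ P (Sum.inl x) := by
      intro x
      by_cases hx : x ∈ X
      · obtain ⟨_, ⟨i, rfl⟩, hnd, hch, hh, hl⟩ := hP (Sum.inl x) ⟨x, hx, rfl⟩
        have hmem := List.mem_of_getLast? hl
        generalize P (Sum.inl x) = p at *
        cases p with
        | nil => simp at hh
        | cons a p =>
          simp only [List.head?_cons, Option.some.injEq] at hh
          subst hh
          cases p with
          | nil => simp at hl
          | cons b p =>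
            rw [List.isChain_cons_cons] at hch
            cases b with
            | inr j => exact absurd hch.1 (by simp [candidateDigraph])
            | inl t =>
              rw [List.getLast?_cons_cons] at hl
              obtain ⟨h1, h2⟩ := isAncestor_of_isChain (t := t) hG hch.2 rfl hl
              exact ⟨i, t, fun _ => ⟨hch.1, by simp, hmem, h1,
                fun z hz hz' => List.mem_cons_of_mem _ (h2 z hz hz')⟩⟩
      · exact ⟨Classical.arbitrary _, x, fun h => absurd h hx⟩
    choose i t hit using key
    refine ⟨i, t, fun x hx y hy hxy => ?_, fun x hx => ⟨(hit x hx).1, hx, (hit x hx).2.2.2.1,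
      fun y hy hty => ?_⟩⟩
    · by_contra hne
      refine hdisj _ ⟨x, hx, rfl⟩ _ ⟨y, hy, rfl⟩ (by simpa using hne) (hit x hx).2.1 ?_
      rw [hxy]
      exact (hit y hy).2.1
    -- If `y` came strictly before `x`, it would lie on the path ending in `x` as well as on its
    -- own.
    · rcases IsAncestor.total hG (hit x hx).2.2.2.1 hty with h | h
      · exact h
      · by_cases hne : x = y
        · rwa [← hne] at h ⊢
        · exact absurd (hit y hy).2.2.1 (hdisj _ ⟨x, hx, rfl⟩ _ ⟨y, hy, rfl⟩
            (by simpa using hne) ((hit x hx).2.2.2.2 y hty h))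
  · rintro ⟨i, t, hinj, hit⟩
    have key : ∀ x : V, ∃ l : List V, x ∈ X → l.IsChain (IsParent G r) ∧ l.head? = some (t x) ∧
        l.getLast? = some x ∧ l.Nodup ∧ ∀ z ∈ l, IsAncestor G r (t x) z ∧ IsAncestor G r z x := by
      intro x
      by_cases hx : x ∈ X
      · obtain ⟨l, hl⟩ := exists_isChain_of_isAncestor (hit x hx).2.2.1
        exact ⟨l, fun _ => hl⟩
      · exact ⟨[], fun h => absurd h hx⟩
    choose l hl using key
    refine ⟨Sum.elim (fun x => Sum.inr (i x) :: (l x).map Sum.inl) fun _ => [], ?_, ?_⟩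
    · rintro _ ⟨x, hx, rfl⟩
      obtain ⟨h1, h2, h3, h4, -⟩ := hl x hx
      refine ⟨Sum.inr (i x), ⟨i x, rfl⟩, ?_, ?_, by simp, ?_⟩
      · simp only [Sum.elim_inl, List.nodup_cons, List.mem_map, reduceCtorEq, and_false,
          exists_false, not_false_eq_true, true_and]
        exact h4.map Sum.inl_injective
      · simp only [Sum.elim_inl, List.isChain_cons, List.head?_map, h2]
        refine ⟨by simpa [candidateDigraph_adj_inr] using (hit x hx).1, ?_⟩
        rw [List.isChain_map]
        exact h1
      · simp [List.getLast?_cons, h3]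
    · rintro _ ⟨x, hx, rfl⟩ _ ⟨y, hy, rfl⟩ hne a ha hb
      have hxy : x ≠ y := fun h => hne (congrArg _ h)
      simp only [Sum.elim_inl, List.mem_cons, List.mem_map] at ha hb
      rcases ha with rfl | ⟨z, hz, rfl⟩
      · rcases hb with hb | ⟨z, -, hz⟩
        · exact hxy (hinj hx hy (Sum.inr_injective hb))
        · cases hz
      · rcases hb with hb | ⟨z', hz', hzz⟩
        · cases hb
        · obtain rfl := Sum.inl_injective hzz
          obtain ⟨h1, h2⟩ := (hl x hx).2.2.2.2 _ hz
          obtain ⟨h3, h4⟩ := (hl y hy).2.2.2.2 _ hz'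
          -- A common node would make `x` and `y` ancestors of both representatives, so each would
          -- precede the other.
          exact hxy (IsAncestor.antisymm ((hit x hx).2.2.2 y hy (h1.trans h4))
            ((hit y hy).2.2.2 x hx (h3.trans h2)))

theorem IsGoodCut.isSingleToSingle {C : Finset (Sym2 V)} (hC : IsGoodCut G T C)
    (hcard : C.card + 1 = q) : IsSingleToSingle G T C := by
  obtain ⟨hE, I, t, hI, ht, hK⟩ := hC
  have hI' : I = Finset.univ := by
    rw [← Finset.card_eq_iff_eq_univ, hI, hcard, Fintype.card_fin]
  subst hI'
  refine ⟨hE, t, fun i => ht i (Finset.mem_univ i), fun i j hij h => hij ?_⟩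
  exact (hK _).unique ⟨Finset.mem_univ i, SimpleGraph.ConnectedComponent.sound h⟩
    ⟨Finset.mem_univ j, rfl⟩

end Linking
-- A generic linear representation of matchability.
section Representation

open scoped Classical in
/-- A matrix of distinct indeterminates in the places `(i, t)` with `t ∈ T i`, and zero elsewhere. -/
noncomputable def genericEntry {V : Type*} {q : ℕ} (T : Fin q → Set V) (i : Fin q) (t : V) :
    MvPolynomial (Fin q × V) ℚ :=
  if t ∈ T i then MvPolynomial.X (i, t) else 0

open scoped Classical in
/-- The sum of the generic columns of the elements of `A`. -/
noncomputable def genericSum {V : Type*} [Fintype V] {q : ℕ} (T : Fin q → Set V) (A : Set V) :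
    Fin q → FractionRing (MvPolynomial (Fin q × V) ℚ) :=
  fun i => algebraMap _ _ (∑ t with t ∈ A, genericEntry T i t)

variable {V : Type*} [Fintype V] {G : SimpleGraph V} {r : V} {q : ℕ} {T : Fin q → Set V}

-- The descendants of `x` are partitioned by their first ancestor in `X`, which is some `y ∈ X` at
-- or below `x`.
open scoped Classical in
theorem genericSum_isAncestor (hG : G.IsTree) {X : Finset V} {x : V} (hx : x ∈ X) :
    genericSum T {t | IsAncestor G r t x} =
      ∑ y ∈ X with IsAncestor G r y x, genericSum T {t | IsFirstAncestor G r X t y} := by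
  ext i
  simp only [genericSum, Finset.sum_apply, ← map_sum]
  congr 1
  rw [← Finset.sum_biUnion]
  · refine Finset.sum_congr ?_ fun _ _ => rfl
    ext t
    simp only [Set.mem_ofPred_eq, Finset.mem_filter, Finset.mem_univ, true_and, Finset.mem_biUnion]
    constructor
    · intro h
      obtain ⟨y, hy⟩ := exists_isFirstAncestor hG (X := (X : Set V)) hx h
      exact ⟨y, ⟨hy.1, hy.2.2 x hx h⟩, hy⟩
    · rintro ⟨y, ⟨-, hy⟩, h⟩
      exact h.2.1.trans hy
  · intro y _ z _ hyz
    rw [Function.onFun, Finset.disjoint_left]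
    intro t ht ht'
    simp only [Set.mem_ofPred_eq, Finset.mem_filter, Finset.mem_univ, true_and] at ht ht'
    exact hyz (ht.unique ht')

/-- The relation between the two families is unitriangular in the tree order. -/
theorem span_genericSum_eq (hG : G.IsTree) (X : Finset V) :
    Submodule.span (FractionRing (MvPolynomial (Fin q × V) ℚ))
      (Set.range fun x : X => genericSum T {t | IsAncestor G r t x}) =
    Submodule.span (FractionRing (MvPolynomial (Fin q × V) ℚ))
      (Set.range fun x : X => genericSum T {t | IsFirstAncestor G r X t x}) := by
  classical
  apply le_antisymm
  · rw [Submodule.span_le]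
    rintro _ ⟨⟨x, hx⟩, rfl⟩
    simp only [SetLike.mem_coe]
    rw [genericSum_isAncestor hG hx]
    exact Submodule.sum_mem _ fun y hy =>
      Submodule.subset_span ⟨⟨y, (Finset.mem_filter.1 hy).1⟩, rfl⟩
  · rw [Submodule.span_le]
    rintro _ ⟨⟨x, hx⟩, rfl⟩
    simp only [SetLike.mem_coe]
    -- The measure counts the descendants of `x`; it drops for `y` strictly below `x`, since `x`
    -- itself is lost.
    induction h : ∑ t : V, (if IsAncestor G r t x then 1 else 0)
      using Nat.strong_induction_on generalizing x with
    | _ n ih =>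
      have h1 := genericSum_isAncestor (T := T) (r := r) hG hx
      have hmem : x ∈ X.filter fun y => IsAncestor G r y x :=
        Finset.mem_filter.2 ⟨hx, Relation.ReflTransGen.refl⟩
      rw [← Finset.add_sum_erase _ _ hmem, ← sub_eq_iff_eq_add] at h1
      rw [← h1]
      refine Submodule.sub_mem _ (Submodule.subset_span ⟨⟨x, hx⟩, rfl⟩)
        (Submodule.sum_mem _ fun y hy => ?_)
      rw [Finset.mem_erase, Finset.mem_filter] at hy
      refine ih _ ?_ y hy.2.1 rfl
      rw [← h]
      refine Finset.sum_lt_sum (fun t _ => ?_) ⟨x, Finset.mem_univ _, ?_⟩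
      · by_cases ht : IsAncestor G r t y
        · have : IsAncestor G r t x := ht.trans hy.2.2
          simp [ht, this]
        · simp [ht]
      · have h2 : ¬ IsAncestor G r x y := fun h2 => hy.1 (IsAncestor.antisymm hy.2.2 h2)
        have h3 : IsAncestor G r x x := Relation.ReflTransGen.refl
        simp [h2, h3]

theorem linearIndependent_genericSum_iff (hG : G.IsTree) (X : Finset V) :
    LinearIndependent (FractionRing (MvPolynomial (Fin q × V) ℚ))
      (fun x : X => genericSum T {t | IsAncestor G r t x}) ↔
    LinearIndependent (FractionRing (MvPolynomial (Fin q × V) ℚ))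
      (fun x : X => genericSum T {t | IsFirstAncestor G r X t x}) := by
  rw [linearIndependent_iff_card_eq_finrank_span, linearIndependent_iff_card_eq_finrank_span,
    Set.finrank, Set.finrank, span_genericSum_eq hG]

/-- Vectors with disjoint generic supports are linearly independent iff there is a system of
distinct representatives. -/
theorem linearIndependent_genericSum_iff_exists {X : Type*} [Fintype X] (B : X → Set V)
    (hB : ∀ x y t, t ∈ B x → t ∈ B y → x = y) :
    LinearIndependent (FractionRing (MvPolynomial (Fin q × V) ℚ)) (fun x => genericSum T (B x)) ↔
      ∃ (i : X → Fin q) (t : X → V), Function.Injective i ∧ ∀ x, t x ∈ T (i x) ∧ t x ∈ B x := by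
  classical
  constructor
  · intro hli
    let N : X → Finset (Fin q) := fun x => Finset.univ.filter fun i => ∃ t ∈ B x, t ∈ T i
    suffices h : ∃ f : X → Fin q, Function.Injective f ∧ ∀ x, f x ∈ N x by
      obtain ⟨f, hf, hfN⟩ := h
      simp only [N, Finset.mem_filter, Finset.mem_univ, true_and] at hfN
      choose t ht using hfN
      exact ⟨f, t, hf, fun x => ⟨(ht x).2, (ht x).1⟩⟩
    -- Hall's condition: the vectors indexed by `s` are independent and lie in the span of the
    -- coordinate vectors of their joint neighbourhood.
    rw [← Finset.all_card_le_biUnion_card_iff_exists_injective]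
    intro s
    have h1 := hli.comp (fun x : s => (x : X)) Subtype.val_injective
    have h2 : ∀ x : s, genericSum T (B x) ∈ Submodule.span
        (FractionRing (MvPolynomial (Fin q × V) ℚ))
        (((s.biUnion N).image fun i => Pi.single i
          (1 : FractionRing (MvPolynomial (Fin q × V) ℚ)) : Finset (Fin q → _)) : Set _) := by
      rintro ⟨x, hx⟩
      rw [← Finset.univ_sum_single (genericSum T (B x))]
      refine Submodule.sum_mem _ fun i _ => ?_
      by_cases hi : i ∈ N x
      · have : Pi.single i (genericSum T (B x) i) = genericSum T (B x) i •
            (Pi.single i (1 : FractionRing (MvPolynomial (Fin q × V) ℚ)) : Fin q → _) := by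
          rw [← Pi.single_smul, smul_eq_mul, mul_one]
        rw [this]
        refine Submodule.smul_mem _ _ (Submodule.subset_span ?_)
        rw [Finset.mem_coe]
        exact Finset.mem_image_of_mem _ (Finset.mem_biUnion.2 ⟨x, hx, hi⟩)
      · have : genericSum T (B x) i = 0 := by
          simp only [genericSum]
          rw [Finset.sum_eq_zero, map_zero]
          intro t ht
          have htB := (Finset.mem_filter.1 ht).2
          rw [genericEntry, if_neg]
          exact fun h => hi (Finset.mem_filter.2 ⟨Finset.mem_univ _, t, htB, h⟩)
        rw [this, Pi.single_zero]
        exact Submodule.zero_mem _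
    have h3 := finrank_span_eq_card h1
    have h4 : Submodule.span (FractionRing (MvPolynomial (Fin q × V) ℚ))
        (Set.range ((fun x => genericSum T (B x)) ∘ fun x : s => (x : X))) ≤ _ :=
      Submodule.span_le.2 (by rintro _ ⟨x, rfl⟩; exact h2 x)
    have h5 := Submodule.finrank_mono h4
    rw [h3, Fintype.card_coe] at h5
    exact h5.trans ((finrank_span_finset_le_card _).trans Finset.card_image_le)
  · rintro ⟨i, t, hi, ht⟩
    let A : Matrix X X (MvPolynomial (Fin q × V) ℚ) := fun x y => ∑ s with s ∈ B x, genericEntry T (i y) s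
    -- Setting the chosen indeterminates to 1 and the others to 0 turns `A` into the identity, as
    -- `i` is injective and the blocks are disjoint.
    let ev : MvPolynomial (Fin q × V) ℚ →+* ℚ := MvPolynomial.eval fun p => if ∃ x, p = (i x, t x) then 1 else 0
    have hA : A.map ev = 1 := by
      ext x y
      have key : ∀ s, ev (genericEntry T (i y) s) = if s = t y then 1 else 0 := by
        intro s
        by_cases hs : s = t y
        · subst hs
          rw [genericEntry, if_pos (ht y).1]
          simp only [ev, MvPolynomial.eval_X, if_pos (⟨y, rfl⟩ : ∃ x, (i y, t y) = (i x, t x)),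
            if_true]
        · rw [genericEntry]
          split_ifs with h
          · have : ¬ ∃ x, (i y, s) = (i x, t x) := by
              rintro ⟨z, hz⟩
              rw [Prod.mk.injEq] at hz
              exact hs (by rw [hz.2, hi hz.1])
            simp only [ev, MvPolynomial.eval_X, if_neg this]
          · simp
      change ev (∑ s with s ∈ B x, genericEntry T (i y) s) = (1 : Matrix X X ℚ) x y
      simp only [map_sum, key, Finset.sum_ite_eq', Finset.mem_filter,
        Finset.mem_univ, true_and, Matrix.one_apply]
      refine if_congr ⟨fun h => hB _ _ _ h (ht y).2, ?_⟩ rfl rfl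
      rintro rfl
      exact (ht x).2
    have hdet : A.det ≠ 0 := by
      intro h
      have h1 := RingHom.map_det ev A
      rw [h, map_zero, RingHom.mapMatrix_apply, hA, Matrix.det_one] at h1
      exact zero_ne_one h1
    have hdet' : (A.map (algebraMap _ (FractionRing (MvPolynomial (Fin q × V) ℚ)))).det ≠ 0 := by
      have h1 := RingHom.map_det (algebraMap _ (FractionRing (MvPolynomial (Fin q × V) ℚ))) A
      rw [RingHom.mapMatrix_apply] at h1
      rw [← h1]
      exact (map_ne_zero_iff _ (IsFractionRing.injective _ (FractionRing (MvPolynomial (Fin q × V) ℚ)))).2 hdet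
    have hrows := Matrix.linearIndependent_rows_of_det_ne_zero hdet'
    -- Independence after restriction to the coordinates `i y` suffices.
    exact LinearIndependent.of_comp (LinearMap.funLeft _ _ i) hrows

theorem isMatchable_iff_linearIndepOn [Nonempty (Fin q)] (hG : G.IsTree) (X : Finset V) :
    IsMatchable G T r X ↔ LinearIndepOn (FractionRing (MvPolynomial (Fin q × V) ℚ))
      (fun x => genericSum T {t | IsAncestor G r t x}) (X : Set V) := by
  classical
  have h := (linearIndependent_genericSum_iff (r := r) (T := T) hG X).trans
    (linearIndependent_genericSum_iff_exists _ fun x y t ht ht' =>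
      Subtype.ext (IsFirstAncestor.unique ht ht'))
  refine Iff.trans ?_ h.symm
  constructor
  · rintro ⟨i, t, hi, ht⟩
    exact ⟨fun x => i x, fun x => t x, fun x y hxy => Subtype.ext (hi x.2 y.2 hxy),
      fun x => ht x x.2⟩
  · rintro ⟨i, t, hi, ht⟩
    refine ⟨fun x => if hx : x ∈ X then i ⟨x, hx⟩ else Classical.arbitrary _,
      fun x => if hx : x ∈ X then t ⟨x, hx⟩ else x, fun x hx y hy hxy => ?_, fun x hx => ?_⟩
    · have hx' : x ∈ X := hx
      have hy' : y ∈ X := hy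
      simp only [dif_pos hx', dif_pos hy'] at hxy
      exact congrArg Subtype.val (hi hxy)
    · have hx' : x ∈ X := hx
      simp only [dif_pos hx']
      exact ht ⟨x, hx'⟩

end Representation

/-! ### The gammoid. -/

section Augmentation

variable {V : Type*} [Finite V] {G : SimpleGraph V} {r : V} {q : ℕ} {T : Fin q → Set V}
  [Nonempty (Fin q)]

theorem IsMatchable.subset (hG : G.IsTree) {X Y : Finset V} (h : IsMatchable G T r X)
    (hYX : Y ⊆ X) : IsMatchable G T r Y := by
  have := Fintype.ofFinite V
  rw [isMatchable_iff_linearIndepOn hG] at h ⊢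
  exact h.mono (by simpa using hYX)

/-- Otherwise the span of the vectors of `Y` would lie in that of `X`, which has smaller dimension.
-/
theorem IsMatchable.augment [DecidableEq V] (hG : G.IsTree) {X Y : Finset V}
    (hX : IsMatchable G T r X)
    (hY : IsMatchable G T r Y) (hlt : X.card < Y.card) :
    ∃ y ∈ Y, y ∉ X ∧ IsMatchable G T r (insert y X : Finset V) := by
  have := Fintype.ofFinite V
  rw [isMatchable_iff_linearIndepOn hG] at hX hY
  by_contra! hcon
  have h1 : Submodule.span (FractionRing (MvPolynomial (Fin q × V) ℚ))
      (Set.range fun y : Y => genericSum T {t | IsAncestor G r t y}) ≤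
      Submodule.span (FractionRing (MvPolynomial (Fin q × V) ℚ))
      (Set.range fun x : X => genericSum T {t | IsAncestor G r t x}) := by
    rw [Submodule.span_le]
    rintro _ ⟨⟨y, hy⟩, rfl⟩
    by_cases hyX : y ∈ X
    · exact Submodule.subset_span ⟨⟨y, hyX⟩, rfl⟩
    · by_contra hns
      refine hcon y hy hyX ?_
      rw [isMatchable_iff_linearIndepOn hG, Finset.coe_insert,
        linearIndepOn_insert (by simpa using hyX)]
      refine ⟨hX, ?_⟩
      rwa [Set.image_eq_range]
  have h2 := Submodule.finrank_mono h1
  have h3 := finrank_span_eq_card hX.linearIndependent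
  have h4 := finrank_span_eq_card hY.linearIndependent
  simp only [Finset.coe_sort_coe, Fintype.card_coe] at h3 h4
  have h5 := h4.symm.trans_le (h2.trans_eq h3)
  omega

theorem exists_isGammoid (hG : G.IsTree) :
    ∃ M : Matroid (V ⊕ Fin q),
      IsGammoid M (candidateDigraph G T r) (Set.range Sum.inr) (Set.range Sum.inl) ∧
      ∀ X : Set V, M.Indep (Sum.inl '' X) ↔ IsMatchable G T r X := by
  classical
  let Ind : Set (V ⊕ Fin q) → Prop := fun I => ∃ X : Finset V, I = Sum.inl '' (X : Set V) ∧
    IsMatchable G T r X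
  let M := (IndepMatroid.ofFinite (E := Set.range (Sum.inl : V → V ⊕ Fin q))
    (Set.finite_range _) Ind ⟨∅, by simp, fun _ => Classical.arbitrary _, id, by simp, by simp⟩
    (by
      rintro I _ ⟨X, rfl, hX⟩ hI
      obtain ⟨Y, hY, rfl⟩ := Set.subset_image_iff.1 hI
      refine ⟨Y.toFinite.toFinset, by simp, hX.subset hG ?_⟩
      simpa using hY)
    (by
      rintro _ _ ⟨X, rfl, hX⟩ ⟨Y, rfl, hY⟩ hlt
      rw [Set.ncard_image_of_injective _ Sum.inl_injective,
        Set.ncard_image_of_injective _ Sum.inl_injective, Set.ncard_coe_finset,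
        Set.ncard_coe_finset] at hlt
      obtain ⟨y, hyY, hyX, hy⟩ := hX.augment hG hY hlt
      exact ⟨Sum.inl y, ⟨y, hyY, rfl⟩, by simpa using hyX, insert y X,
        by rw [Finset.coe_insert, Set.image_insert_eq], hy⟩)
    (by
      rintro _ ⟨X, rfl, -⟩
      exact Set.image_subset_range _ _)).matroid
  have hM : ∀ X : Set V, M.Indep (Sum.inl '' X) ↔ IsMatchable G T r X := by
    intro X
    constructor
    · rintro ⟨Y, hY, h⟩
      rwa [Sum.inl_injective.image_injective hY]
    · exact fun h => ⟨X.toFinite.toFinset, by simp, by simpa using h⟩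
  refine ⟨M, ⟨?_, rfl, ?_⟩, hM⟩
  · rw [Set.disjoint_left]
    rintro _ ⟨i, rfl⟩ ⟨v, hv⟩
    cases hv
  · intro I hI
    obtain ⟨X, rfl⟩ := Set.subset_range_iff_exists_image_eq.1 hI
    rw [hM, isLinkedInto_iff_isMatchable hG]

end Augmentation
-- Good cuts as matchable node sets.
section Cuts

variable {V : Type*} [Finite V] {G : SimpleGraph V} {r : V} {q : ℕ} {T : Fin q → Set V}

theorem mem_outCut {Z : Finset V} {e : Sym2 V} :
    e ∈ outCut G r Z ↔ ∃ v ∈ Z, ∃ u, IsParent G r v u ∧ e = s(v, u) := by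
  simp [outCut, IsParent, and_assoc]

theorem IsParent.edge_mem_outCut {u v : V} (h : IsParent G r v u) {Z : Finset V} :
    s(v, u) ∈ outCut G r Z ↔ v ∈ Z := by
  rw [mem_outCut]
  constructor
  · rintro ⟨v', hv', u', h', he⟩
    rwa [h.eq_of_edge_eq h' he]
  · exact fun hv => ⟨v, hv, u, h, rfl⟩

theorem outCut_subset_edgeSet (Z : Finset V) : (outCut G r Z : Set (Sym2 V)) ⊆ G.edgeSet := by
  intro e he
  obtain ⟨v, -, u, h, rfl⟩ := mem_outCut.1 he
  exact h.1

theorem outCut_subset_iff (hG : G.IsTree) {Z W : Finset V} (hZ : r ∉ Z) :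
    outCut G r Z ⊆ outCut G r W ↔ Z ⊆ W := by
  constructor
  · intro h v hv
    obtain ⟨u, hu, -⟩ := hG.existsUnique_isParent fun h : v = r => hZ (h ▸ hv)
    exact hu.edge_mem_outCut.1 (h (hu.edge_mem_outCut.2 hv))
  · intro h e he
    obtain ⟨v, hv, u, hu, rfl⟩ := mem_outCut.1 he
    exact hu.edge_mem_outCut.2 (h hv)

theorem exists_outCut_eq (hG : G.IsTree) (r : V) {C : Finset (Sym2 V)}
    (hC : (C : Set (Sym2 V)) ⊆ G.edgeSet) : ∃ Z : Finset V, r ∉ Z ∧ outCut G r Z = C := by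
  refine ⟨(Set.toFinite {v : V | ∃ u, IsParent G r v u ∧ s(v, u) ∈ C}).toFinset, ?_, ?_⟩
  · rw [Set.Finite.mem_toFinset]
    rintro ⟨u, hu, -⟩
    exact hu.ne_root rfl
  · ext e
    rw [mem_outCut]
    constructor
    · rintro ⟨v, hv, u, hu, rfl⟩
      rw [Set.Finite.mem_toFinset] at hv
      obtain ⟨u', hu', hC'⟩ := hv
      rwa [hu.unique hG hu']
    · intro he
      have hedge := hC he
      induction e with
      | _ a b =>
        rcases hG.isParent_or_isParent r (show G.Adj a b from hedge) with h | h
        · exact ⟨a, (Set.Finite.mem_toFinset _).2 ⟨b, h, he⟩, b, h, rfl⟩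
        · exact ⟨b, (Set.Finite.mem_toFinset _).2 ⟨a, h, Sym2.eq_swap ▸ he⟩, a, h, Sym2.eq_swap⟩

theorem bijOn_outCut (hG : G.IsTree) (r : V) :
    Set.BijOn (outCut G r) {Z : Finset V | r ∉ Z}
      {C : Finset (Sym2 V) | (C : Set (Sym2 V)) ⊆ G.edgeSet} := by
  refine ⟨fun Z _ => outCut_subset_edgeSet Z, fun Z hZ W hW h => ?_,
    fun C hC => exists_outCut_eq hG r hC⟩
  exact ((outCut_subset_iff hG hZ).1 h.subset).antisymm ((outCut_subset_iff hG hW).1 h.superset)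

theorem card_outCut (hG : G.IsTree) {Z : Finset V} (hZ : r ∉ Z) :
    (outCut G r Z).card = Z.card := by
  have hex : ∀ v ∈ Z, ∃ u, IsParent G r v u := fun v hv =>
    (hG.existsUnique_isParent fun h : v = r => hZ (h ▸ hv)).exists
  choose! p hp using hex
  refine (Finset.card_bij (fun v _ => s(v, p v)) (fun v hv => ?_) (fun v hv w hw h => ?_)
    fun e he => ?_).symm
  · exact (hp v hv).edge_mem_outCut.2 hv
  · exact (hp v hv).eq_of_edge_eq (hp w hw) h
  · obtain ⟨v, hv, u, hu, rfl⟩ := mem_outCut.1 he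
    exact ⟨v, hv, by rw [(hp v hv).unique hG hu]⟩

/-- Nodes strictly before the first ancestor are outside `Z`, so the edges leaving them survive. -/
theorem IsFirstAncestor.reachable {Z : Finset V} {u x : V}
    (h : IsFirstAncestor G r (insert r (Z : Set V)) u x) :
    (G.deleteEdges (outCut G r Z : Set (Sym2 V))).Reachable u x := by
  obtain ⟨hx, hux, hfirst⟩ := h
  induction hux using Relation.ReflTransGen.head_induction_on with
  | refl => exact SimpleGraph.Reachable.refl _
  | @head a c hac hcx ih =>
    have haX : a ∉ insert r (Z : Set V) := by
      intro ha
      have h1 := IsAncestor.dist_le (hfirst a ha Relation.ReflTransGen.refl)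
      have h2 := IsAncestor.dist_le hcx
      have h3 := hac.2
      omega
    refine SimpleGraph.Reachable.trans (SimpleGraph.Adj.reachable ?_)
      (ih fun y hy hcy => hfirst y hy (Relation.ReflTransGen.head hac hcy))
    rw [SimpleGraph.deleteEdges_adj]
    refine ⟨hac.1, fun he => haX (Or.inr ?_)⟩
    exact hac.edge_mem_outCut.1 he

theorem isFirstAncestor_iff_of_reachable (hG : G.IsTree) {Z : Finset V} {u v x : V}
    (h : (G.deleteEdges (outCut G r Z : Set (Sym2 V))).Reachable u v) :
    IsFirstAncestor G r (insert r (Z : Set V)) u x ↔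
      IsFirstAncestor G r (insert r (Z : Set V)) v x := by
  obtain ⟨p⟩ := h
  induction p with
  | nil => rfl
  | @cons a b c hab _ ih =>
    refine Iff.trans ?_ ih
    rw [SimpleGraph.deleteEdges_adj] at hab
    rcases hG.isParent_or_isParent r hab.1 with hp | hp
    · refine hp.isFirstAncestor_iff hG ?_
      rintro (ha | ha)
      · exact hp.ne_root ha
      · exact hab.2 (hp.edge_mem_outCut.2 ha)
    · refine (hp.isFirstAncestor_iff hG ?_).symm
      rintro (ha | ha)
      · exact hp.ne_root ha
      · exact hab.2 (Sym2.eq_swap ▸ hp.edge_mem_outCut.2 ha)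

theorem isGoodCut_outCut_iff (hG : G.IsTree) {Z : Finset V} (hZ : r ∉ Z) :
    IsGoodCut G T (outCut G r Z) ↔ IsMatchable G T r (insert r (Z : Set V)) := by
  classical
  constructor
  · rintro ⟨-, I, t, -, ht, hK⟩
    have hex := fun x : V => (hK (SimpleGraph.connectedComponentMk _ x)).exists
    choose i hiI hi using hex
    -- For each node `x`, `t (i x)` is the representative in the component of `x`.
    have hreach := fun x => SimpleGraph.ConnectedComponent.exact (hi x)
    have hfirst : ∀ x ∈ insert r (Z : Set V),
        IsFirstAncestor G r (insert r (Z : Set V)) (t (i x)) x := fun x hx =>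
      (isFirstAncestor_iff_of_reachable hG (hreach x)).2 (IsFirstAncestor.self hx)
    refine ⟨i, fun x => t (i x), fun x hx y hy hxy => ?_, fun x hx => ⟨ht _ (hiI x), hfirst x hx⟩⟩
    exact (hfirst x hx).unique (hxy ▸ hfirst y hy)
  · rintro ⟨i, t, hi, ht⟩
    have : Nonempty V := ⟨r⟩
    refine ⟨outCut_subset_edgeSet Z, (insert r Z).image i,
      fun j => t (Function.invFunOn i (insert r (Z : Set V)) j), ?_, ?_, ?_⟩
    · rw [Finset.card_image_of_injOn (by simpa using hi), card_outCut hG hZ,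
        Finset.card_insert_of_notMem hZ]
    · intro j hj
      obtain ⟨x, hx, rfl⟩ := Finset.mem_image.1 hj
      have hx' : x ∈ insert r (Z : Set V) := by simpa using hx
      dsimp only
      rw [hi.leftInvOn_invFunOn hx']
      exact (ht x hx').1
    · refine SimpleGraph.ConnectedComponent.ind fun u => ?_
      obtain ⟨x, hx⟩ := exists_isFirstAncestor hG (X := insert r (Z : Set V))
        (Set.mem_insert r _) (hG.isAncestor_root u)
      refine ⟨i x, ⟨Finset.mem_image_of_mem _ (by simpa using hx.1), ?_⟩, ?_⟩
      · dsimp only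
        rw [hi.leftInvOn_invFunOn hx.1, SimpleGraph.ConnectedComponent.eq]
        exact ((ht x hx.1).2.reachable).trans (hx.reachable).symm
      · rintro j ⟨hj, hju⟩
        obtain ⟨y, hy, rfl⟩ := Finset.mem_image.1 hj
        have hy' : y ∈ insert r (Z : Set V) := by simpa using hy
        dsimp only at hju
        rw [hi.leftInvOn_invFunOn hy', SimpleGraph.ConnectedComponent.eq] at hju
        rw [((isFirstAncestor_iff_of_reachable hG hju).1 (ht y hy').2).unique hx]

theorem IsGoodCut.subset [Nonempty (Fin q)] (hG : G.IsTree) {C D : Finset (Sym2 V)}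
    (hC : IsGoodCut G T C) (hDC : D ⊆ C) : IsGoodCut G T D := by
  classical
  obtain ⟨r⟩ := hG.connected.nonempty
  have hD : (D : Set (Sym2 V)) ⊆ G.edgeSet := fun e he => hC.1 (hDC he)
  obtain ⟨Z, hZ, rfl⟩ := exists_outCut_eq hG r hC.1
  obtain ⟨W, hW, rfl⟩ := exists_outCut_eq hG r hD
  rw [outCut_subset_iff hG hW] at hDC
  rw [isGoodCut_outCut_iff hG hZ, ← Finset.coe_insert] at hC
  rw [isGoodCut_outCut_iff hG hW, ← Finset.coe_insert]
  exact hC.subset hG (Finset.insert_subset_insert r hDC)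

theorem IsGoodCut.augment [DecidableEq V] [Nonempty (Fin q)] (hG : G.IsTree)
    {C D : Finset (Sym2 V)} (hC : IsGoodCut G T C) (hD : IsGoodCut G T D)
    (hlt : C.card < D.card) : ∃ e ∈ D, e ∉ C ∧ IsGoodCut G T (insert e C) := by
  obtain ⟨r⟩ := hG.connected.nonempty
  obtain ⟨Z, hZ, rfl⟩ := exists_outCut_eq hG r hC.1
  obtain ⟨W, hW, rfl⟩ := exists_outCut_eq hG r hD.1
  rw [card_outCut hG hZ, card_outCut hG hW] at hlt
  rw [isGoodCut_outCut_iff hG hZ, ← Finset.coe_insert] at hC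
  rw [isGoodCut_outCut_iff hG hW, ← Finset.coe_insert] at hD
  obtain ⟨v, hv, hvZ, hv'⟩ := hC.augment hG hD (by
    rwa [Finset.card_insert_of_notMem hZ, Finset.card_insert_of_notMem hW, Nat.add_lt_add_iff_right])
  rw [Finset.mem_insert, not_or] at hvZ
  have hvW := (Finset.mem_insert.1 hv).resolve_left hvZ.1
  obtain ⟨u, hu, -⟩ := hG.existsUnique_isParent hvZ.1
  refine ⟨s(v, u), hu.edge_mem_outCut.2 hvW, fun h => hvZ.2 (hu.edge_mem_outCut.1 h), ?_⟩
  have heq : insert s(v, u) (outCut G r Z) = outCut G r (insert v Z) := by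
    ext e
    rw [Finset.mem_insert, mem_outCut, mem_outCut]
    constructor
    · rintro (rfl | ⟨z, hz, y, hy⟩)
      · exact ⟨v, Finset.mem_insert_self _ _, u, hu, rfl⟩
      · exact ⟨z, Finset.mem_insert_of_mem hz, y, hy⟩
    · rintro ⟨z, hz, y, hy, rfl⟩
      rcases Finset.mem_insert.1 hz with rfl | hz
      · rw [hy.unique hG hu]; exact Or.inl rfl
      · exact Or.inr ⟨z, hz, y, hy, rfl⟩
  rw [heq, isGoodCut_outCut_iff hG, ← Finset.coe_insert, Finset.insert_comm]
  · exact hv'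
  · rw [Finset.mem_insert, not_or]
    exact ⟨Ne.symm hvZ.1, hZ⟩

/-- Of the components of the cut tree, keep the top nodes of those containing a representative.
Dropping the other cut edges merges each remaining component into one above it. -/
theorem IsSingleToSingle.exists_isGoodCut [Nonempty (Fin q)] (hG : G.IsTree)
    {C : Finset (Sym2 V)} (hC : IsSingleToSingle G T C) :
    ∃ D ⊆ C, D.card + 1 = q ∧ IsGoodCut G T D := by
  classical
  obtain ⟨hE, t, ht, hsep⟩ := hC
  obtain ⟨i₀⟩ := ‹Nonempty (Fin q)›
  -- Rooting at a representative puts the root among the top nodes kept, so exactly q - 1 edges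
  -- remain.
  obtain ⟨Z, hZ, rfl⟩ := exists_outCut_eq hG (t i₀) hE
  have hex := fun i => exists_isFirstAncestor hG (X := insert (t i₀) (Z : Set V))
    (Set.mem_insert _ _) (hG.isAncestor_root (t i))
  choose f hf using hex
  have hinj : Function.Injective f := by
    intro i j hij
    by_contra hne
    refine hsep i j hne (((hf i).reachable).trans ?_)
    rw [hij]
    exact ((hf j).reachable).symm
  have hf₀ : f i₀ = t i₀ := (hf i₀).unique (IsFirstAncestor.self (Set.mem_insert _ _))
  have hmem : t i₀ ∈ Finset.univ.image f := Finset.mem_image.2 ⟨i₀, Finset.mem_univ _, hf₀⟩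
  have hX : insert (t i₀) (((Finset.univ.image f).erase (t i₀) : Finset V) : Set V) =
      Set.range f := by
    rw [← Finset.coe_insert, Finset.insert_erase hmem, Finset.coe_image, Finset.coe_univ,
      Set.image_univ]
  have hnot : t i₀ ∉ (Finset.univ.image f).erase (t i₀) := Finset.notMem_erase _ _
  refine ⟨outCut G (t i₀) ((Finset.univ.image f).erase (t i₀)), ?_, ?_, ?_⟩
  · rw [outCut_subset_iff hG hnot]
    intro x hx
    rw [Finset.mem_erase, Finset.mem_image] at hx
    obtain ⟨hx₀, i, -, rfl⟩ := hx
    exact (hf i).1.resolve_left hx₀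
  · rw [card_outCut hG hnot, Finset.card_erase_add_one hmem,
      Finset.card_image_of_injective _ hinj, Finset.card_univ, Fintype.card_fin]
  · rw [isGoodCut_outCut_iff hG hnot, hX]
    have : Nonempty (Fin q) := ⟨i₀⟩
    have hinv := Function.leftInverse_invFun hinj
    refine ⟨Function.invFun f, fun x => t (Function.invFun f x), ?_, ?_⟩
    · rintro _ ⟨i, rfl⟩ _ ⟨j, rfl⟩ hij
      rw [hinv, hinv] at hij
      rw [hij]
    · rintro _ ⟨i, rfl⟩
      dsimp only
      rw [hinv]
      refine ⟨ht i, (hf i).mono ?_ ⟨i, rfl⟩⟩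
      rintro _ ⟨j, rfl⟩
      exact (hf j).1

end Cuts

/-! ### Correctness of the greedy algorithm by exchange. -/

section Greedy

variable {V : Type*} [Finite V] [DecidableEq V] {G : SimpleGraph V} {w : Sym2 V → ℝ} {q : ℕ}
  {T : Fin q → Set V} [Nonempty (Fin q)]

theorem IsGoodCut.exists_extension (hG : G.IsTree) {C D : Finset (Sym2 V)}
    (hC : IsGoodCut G T C) (hD : IsGoodCut G T D) (hle : C.card ≤ D.card) :
    ∃ B, C ⊆ B ∧ B ⊆ C ∪ D ∧ B.card = D.card ∧ IsGoodCut G T B := by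
  induction h : D.card - C.card generalizing C with
  | zero => exact ⟨C, subset_rfl, Finset.subset_union_left, by omega, hC⟩
  | succ n ih =>
    obtain ⟨e, heD, heC, he⟩ := hC.augment hG hD (by omega)
    have hcard := Finset.card_insert_of_notMem heC
    obtain ⟨B, h1, h2, h3, h4⟩ := ih he (by omega) (by omega)
    refine ⟨B, (Finset.subset_insert _ _).trans h1, h2.trans ?_, h3, h4⟩
    rw [Finset.insert_union]
    exact Finset.insert_subset (Finset.mem_union_right _ heD) subset_rfl

theorem IsGoodCut.exists_greedyStep (hG : G.IsTree) {C D : Finset (Sym2 V)}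
    (hC : IsGoodCut G T C) (hD : IsGoodCut G T D) (hDcard : D.card + 1 = q)
    (hlt : C.card + 1 < q) : ∃ C', GreedyStep G w T C C' := by
  obtain ⟨e, -, heC, he⟩ := hC.augment hG hD (by omega)
  obtain ⟨f, ⟨hfC, hf⟩, hmin⟩ :=
    (Set.toFinite {e | e ∉ C ∧ IsGoodCut G T (insert e C)}).exists_minimalFor w _ ⟨e, heC, he⟩
  refine ⟨insert f C, hlt, f, hfC, hf, fun g hgC hg => ?_, rfl⟩
  exact (le_total (w f) (w g)).elim id fun h => hmin ⟨hgC, hg⟩ h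

/-- Extending `C + e` inside `B + e` gives `B' = B + e - f` with `f ∉ C`. As `C + f ⊆ B` is good,
`f` was also available to greedy, so `w e ≤ w f`. -/
theorem GreedyStep.exists_optimal_superset (hG : G.IsTree) {C C' B : Finset (Sym2 V)}
    (h : GreedyStep G w T C C') (hCB : C ⊆ B) (hB : IsGoodCut G T B) (hBcard : B.card + 1 = q) :
    ∃ B', C' ⊆ B' ∧ IsGoodCut G T B' ∧ B'.card = B.card ∧ ∑ e ∈ B', w e ≤ ∑ e ∈ B, w e := by
  obtain ⟨hlt, e, heC, he, hmin, rfl⟩ := h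
  by_cases heB : e ∈ B
  · exact ⟨B, Finset.insert_subset heB hCB, hB, rfl, le_rfl⟩
  · have hcard := Finset.card_insert_of_notMem heC
    obtain ⟨B', h1, h2, h3, h4⟩ := he.exists_extension hG hB (by omega)
    rw [Finset.insert_union, Finset.union_eq_right.2 hCB] at h2
    have hdiff : (insert e B \ B').card = 1 := by
      rw [Finset.card_sdiff_of_subset h2, Finset.card_insert_of_notMem heB, h3]
      omega
    obtain ⟨f, hf⟩ := Finset.card_eq_one.1 hdiff
    have hfm : f ∈ insert e B \ B' := hf ▸ Finset.mem_singleton_self f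
    rw [Finset.mem_sdiff, Finset.mem_insert] at hfm
    have hfC : f ∉ insert e C := fun h => hfm.2 (h1 h)
    rw [Finset.mem_insert, not_or] at hfC
    have hfB := hfm.1.resolve_left hfC.1
    have hle := hmin f hfC.2 (hB.subset hG (Finset.insert_subset hfB hCB))
    have hsum := Finset.sum_sdiff (f := w) h2
    rw [hf, Finset.sum_singleton, Finset.sum_insert heB] at hsum
    exact ⟨B', h1, h4, h3, by linarith⟩

theorem GreedyReaches.exists_optimal_superset (hG : G.IsTree) {C B : Finset (Sym2 V)}
    (h : GreedyReaches G w T C) (hB : IsGoodCut G T B) (hBcard : B.card + 1 = q) :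
    ∃ B', C ⊆ B' ∧ IsGoodCut G T B' ∧ B'.card = B.card ∧ ∑ e ∈ B', w e ≤ ∑ e ∈ B, w e := by
  induction h with
  | refl => exact ⟨B, Finset.empty_subset _, hB, rfl, le_rfl⟩
  | tail _ hstep ih =>
    obtain ⟨B₁, h1, h2, h3, h4⟩ := ih
    obtain ⟨B₂, h5, h6, h7, h8⟩ := hstep.exists_optimal_superset hG h1 h2 (by omega)
    exact ⟨B₂, h5, h6, h7.trans h3, h8.trans h4⟩

theorem exists_isGreedyOutput (hG : G.IsTree) {C D : Finset (Sym2 V)}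
    (hC : GreedyReaches G w T C) (hD : IsGoodCut G T D) (hDcard : D.card + 1 = q) :
    ∃ B, IsGreedyOutput G w T B := by
  induction h : q - C.card using Nat.strong_induction_on generalizing C with
  | _ n ih =>
    by_cases hlt : C.card + 1 < q
    · obtain ⟨B, h1, h2, -, -⟩ := hC.exists_optimal_superset hG hD hDcard
      obtain ⟨C', hC'⟩ := (h2.subset hG h1).exists_greedyStep (w := w) hG hD hDcard hlt
      refine ih _ ?_ (hC.tail hC') rfl
      obtain ⟨-, e, heC, -, -, rfl⟩ := hC'
      rw [Finset.card_insert_of_notMem heC]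
      omega
    · exact ⟨C, hC, hlt⟩

end Greedy

theorem mainTheorem3 {V : Type*} [Finite V] [DecidableEq V] (G : SimpleGraph V) (hG : G.IsTree)
    (w : Sym2 V → ℝ) (hw : ∀ e ∈ G.edgeSet, 0 ≤ w e) {q : ℕ} (hq : 1 ≤ q) (T : Fin q → Set V) :
    -- good cuts are described by the gammoid, for every root `r`
    (∀ r : V,
      (∀ v : V, v ≠ r → ∃! u : V, (candidateDigraph G T r).Adj (Sum.inl v) (Sum.inl u)) ∧
      Set.BijOn (outCut G r) {Z : Finset V | r ∉ Z}
        {C : Finset (Sym2 V) | (C : Set (Sym2 V)) ⊆ G.edgeSet} ∧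
      ∃ M : Matroid (V ⊕ Fin q),
        IsGammoid M (candidateDigraph G T r) (Set.range Sum.inr) (Set.range Sum.inl) ∧
        ∀ Z : Finset V, r ∉ Z →
          (IsGoodCut G T (outCut G r Z) ↔
            M.Indep (Sum.inl '' (insert r (Z : Set V))))) ∧
    -- the greedy algorithm is correct on every feasible instance
    ((∃ C : Finset (Sym2 V), IsSingleToSingle G T C) →
      (∀ C : Finset (Sym2 V), GreedyReaches G w T C → C.card + 1 < q →
        ∃ C' : Finset (Sym2 V), GreedyStep G w T C C') ∧
      (∃ C : Finset (Sym2 V), IsGreedyOutput G w T C) ∧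
      ∀ C : Finset (Sym2 V), IsGreedyOutput G w T C →
        C.card = q - 1 ∧ IsGoodCut G T C ∧
        (∀ C' : Finset (Sym2 V), C'.card = q - 1 → IsGoodCut G T C' →
          ∑ e ∈ C, w e ≤ ∑ e ∈ C', w e) ∧
        IsOptimalSingleToSingle G w T C) := by
  refine ⟨?_, ?_⟩
  · intro r
    have : Nonempty (Fin q) := ⟨⟨0, hq⟩⟩
    obtain ⟨M, hM, hind⟩ := exists_isGammoid (r := r) (T := T) hG
    refine ⟨fun v hv => hG.existsUnique_isParent hv, bijOn_outCut hG r, M, hM, fun Z hZ => ?_⟩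
    rw [isGoodCut_outCut_iff hG hZ, hind]
  · rintro ⟨C₀, hC₀⟩
    have : Nonempty (Fin q) := ⟨⟨0, hq⟩⟩
    obtain ⟨D, -, hDcard, hD⟩ := hC₀.exists_isGoodCut hG
    refine ⟨fun C hC hlt => ?_,
      exists_isGreedyOutput hG (C := ∅) Relation.ReflTransGen.refl hD hDcard, ?_⟩
    · obtain ⟨B, h1, h2, -, -⟩ := hC.exists_optimal_superset hG hD hDcard
      exact (h2.subset hG h1).exists_greedyStep hG hD hDcard hlt
    · rintro C ⟨hC, hdone⟩
      -- The final `C` has at least q - 1 edges, so the superset `B'` obtained from any competitor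
      -- `B` must equal `C`.
      have heq : ∀ B : Finset (Sym2 V), B.card + 1 = q → IsGoodCut G T B →
          IsGoodCut G T C ∧ C.card + 1 = q ∧ ∑ e ∈ C, w e ≤ ∑ e ∈ B, w e := by
        intro B hBcard hB
        obtain ⟨B', h1, h2, h3, h4⟩ := hC.exists_optimal_superset hG hB hBcard
        obtain rfl := Finset.eq_of_subset_of_card_le h1 (by omega)
        exact ⟨h2, by omega, h4⟩
      obtain ⟨hgood, hcard, -⟩ := heq D hDcard hD
      refine ⟨by omega, hgood, fun C' hcard' hC' => (heq C' (by omega) hC').2.2,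
        hgood.isSingleToSingle hcard, fun C' hC' => ?_⟩
      obtain ⟨B, hBC, hBcard, hB⟩ := hC'.exists_isGoodCut hG
      exact (heq B hBcard hB).2.2.trans
        (Finset.sum_le_sum_of_subset_of_nonneg hBC fun e he _ => hw e (hC'.1 he))
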